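/- Fix finitely many packet fields, each with a finite set of values. NetKAT predicates are $a,b ::= 1 \mid 0 \mid f=n \mid a+b \mid a\cdot b \mid \neg a$, and NetKAT policies are $p,q ::= a \mid f\leftarrow n \mid p+q \mid p\cdot q \mid p^* \mid \mathbf{dup}$, where $f$ is a field and $n$ a value of $f$. Write $\vdash e\equiv e'$ if the equation $e\equiv e'$ is derivable, by equational reasoning, from the NetKAT axioms: * the Kleene algebra axioms for all policies $p,q,r$ (with $p\le q$ for $p+q\equiv q$): $+$ is associative, commutative and idempotent with unit $0$; $\cdot$ is associative with two-sided unit $1$ and two-sided zero $0$, and distributes over $+$ on both sides; $1+p\cdot p^*\equiv p^*$; $1+p^*\cdot p\equiv p^*$; if $q+p\cdot r\le r$ then $p^*\cdot q\le r$; if $p+q\cdot r\le q$ then $p\cdot r^*\le q$; * the Boolean algebra axioms for all predicates $a,b,c$: $a+(b\cdot c)\equiv(a+b)\cdot(a+c)$; $a+1\equiv 1$; $a+\neg a\equiv 1$; $a\cdot b\equiv b\cdot a$; $a\cdot\neg a\equiv 0$; $a\cdot a\equiv a$; * the packet algebra axioms: $f\leftarrow n\cdot f'\leftarrow n'\equiv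 f'\leftarrow n'\cdot f\leftarrow n$ and $f\leftarrow n\cdot f'=n'\equiv f'=n'\cdot f\leftarrow n$ if $f\ne f'$; $\mathbf{dup}\cdot f=n\equiv f=n\cdot\mathbf{dup}$; $f\leftarrow n\cdot f=n\equiv f\leftarrow n$; $f=n\cdot f\leftarrow n\equiv f=n$; $f\leftarrow n\cdot f\leftarrow n'\equiv f\leftarrow n'$; $f=n\cdot f=n'\equiv 0$ if $n\ne n'$; $\sum_i f=i\equiv 1$, the sum being over all values $i$ of $f$. For a policy $q$ put $q^0=1$ and $q^{m}=q\cdot q^{m-1}$ for $m\ge 1$. **Theorem (Approximation Principle for Safety).** For all NetKAT policies $t$ (topology), $p$ (switch policy), $\mathit{in}$ (ingress) and $\mathit{out}$ (egress), $$\vdash \mathit{in}\cdot(p\cdot t)^*\cdot\mathit{out}\equiv 0 \quad\text{if and only if}\quad \text{for every } n\in\mathbb{N},\ \vdash \mathit{in}\cdot(1+p\cdot t)^n\cdot\mathit{out}\equiv 0 .$$ -/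

import Mathlib

universe u v

namespace NetKAT

/-- NetKAT predicates over fields `Field`, where the field `f` takes values in `Val f`. -/
inductive Pred (Field : Type u) (Val : Field → Type v) : Type (max u v)
  | one : Pred Field Val
  | zero : Pred Field Val
  | test (f : Field) (n : Val f) : Pred Field Val
  | or (a b : Pred Field Val) : Pred Field Val
  | and (a b : Pred Field Val) : Pred Field Val
  | not (a : Pred Field Val) : Pred Field Val

/-- NetKAT policies. Predicates are policies, and the disjunction and the conjunction of predicates
are written with the same symbols as the union and the sequential composition of policies. Hence
union and sequential composition occur only once here, negation applies to predicates only, and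
`Pred.toPolicy` below is the inclusion of predicates (filters) into policies. -/
inductive Policy (Field : Type u) (Val : Field → Type v) : Type (max u v)
  | one : Policy Field Val
  | zero : Policy Field Val
  | test (f : Field) (n : Val f) : Policy Field Val
  | not (a : Pred Field Val) : Policy Field Val
  | mod (f : Field) (n : Val f) : Policy Field Val
  | union (p q : Policy Field Val) : Policy Field Val
  | seq (p q : Policy Field Val) : Policy Field Val
  | star (p : Policy Field Val) : Policy Field Val
  | dup : Policy Field Val

variable {Field : Type u} {Val : Field → Type v}

instance : Zero (Policy Field Val) := ⟨Policy.zero⟩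
instance : One (Policy Field Val) := ⟨Policy.one⟩
instance : Add (Policy Field Val) := ⟨Policy.union⟩
instance : Mul (Policy Field Val) := ⟨Policy.seq⟩

/-- The inclusion of predicates into policies (a predicate used as a filter). -/
def Pred.toPolicy : Pred Field Val → Policy Field Val
  | .one => 1
  | .zero => 0
  | .test f n => Policy.test f n
  | .or a b => a.toPolicy + b.toPolicy
  | .and a b => a.toPolicy * b.toPolicy
  | .not a => Policy.not a

instance : Coe (Pred Field Val) (Policy Field Val) := ⟨Pred.toPolicy⟩

/-- Repetitions: `q ^ 0 = 1` and `q ^ (m + 1) = q · q ^ m`. -/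
def Policy.rep (q : Policy Field Val) : ℕ → Policy Field Val
  | 0 => 1
  | m + 1 => q * q.rep m

/-- The policy `Σ i, f = i`, the sum over all values of the field `f`. -/
noncomputable def Policy.sumTests (f : Field) [Fintype (Val f)] : Policy Field Val :=
  ((Finset.univ : Finset (Val f)).toList.map (fun i => Policy.test f i)).foldr (· + ·) 0

open Policy in
/-- `Provable e e'` is `⊢ e ≡ e'`: derivability of the equation from the NetKAT axioms by
equational reasoning (`p ≤ q` abbreviates `p + q ≡ q`). -/
inductive Provable [∀ f, Fintype (Val f)] : Policy Field Val → Policy Field Val → Prop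
  -- equational logic
  | refl (p) : Provable p p
  | symm {p q} : Provable p q → Provable q p
  | trans {p q r} : Provable p q → Provable q r → Provable p r
  | union_congr {p p' q q'} : Provable p p' → Provable q q' → Provable (p + q) (p' + q')
  | seq_congr {p p' q q'} : Provable p p' → Provable q q' → Provable (p * q) (p' * q')
  | star_congr {p p'} : Provable p p' → Provable (star p) (star p')
  | not_congr {a b : Pred Field Val} :
      Provable a.toPolicy b.toPolicy → Provable (Policy.not a) (Policy.not b)
  -- Kleene algebra
  | ka_plus_assoc (p q r) : Provable (p + (q + r)) ((p + q) + r)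
  | ka_plus_comm (p q) : Provable (p + q) (q + p)
  | ka_plus_zero (p) : Provable (p + 0) p
  | ka_plus_idem (p) : Provable (p + p) p
  | ka_seq_assoc (p q r) : Provable (p * (q * r)) ((p * q) * r)
  | ka_one_seq (p) : Provable (1 * p) p
  | ka_seq_one (p) : Provable (p * 1) p
  | ka_seq_dist_l (p q r) : Provable (p * (q + r)) (p * q + p * r)
  | ka_seq_dist_r (p q r) : Provable ((p + q) * r) (p * r + q * r)
  | ka_zero_seq (p) : Provable (0 * p) 0
  | ka_seq_zero (p) : Provable (p * 0) 0
  | ka_unroll_l (p) : Provable (1 + p * star p) (star p)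
  | ka_unroll_r (p) : Provable (1 + star p * p) (star p)
  | ka_lfp_l {p q r} : Provable ((q + p * r) + r) r → Provable (star p * q + r) r
  | ka_lfp_r {p q r} : Provable ((p + q * r) + q) q → Provable (p * star r + q) q
  -- Boolean algebra (for predicates)
  | ba_plus_dist (a b c : Pred Field Val) :
      Provable (a + (b.toPolicy * c)) ((a.toPolicy + b) * (a.toPolicy + c))
  | ba_plus_one (a : Pred Field Val) : Provable (a + 1) 1
  | ba_excl_mid (a : Pred Field Val) : Provable (a + Policy.not a) 1
  | ba_seq_comm (a b : Pred Field Val) : Provable (a.toPolicy * b) (b.toPolicy * a)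
  | ba_contra (a : Pred Field Val) : Provable (a * Policy.not a) 0
  | ba_seq_idem (a : Pred Field Val) : Provable (a.toPolicy * a) a
  -- packet algebra
  | pa_mod_mod_comm {f f' : Field} (n : Val f) (n' : Val f') : f ≠ f' →
      Provable (mod f n * mod f' n') (mod f' n' * mod f n)
  | pa_mod_filter_comm {f f' : Field} (n : Val f) (n' : Val f') : f ≠ f' →
      Provable (mod f n * test f' n') (test f' n' * mod f n)
  | pa_dup_filter_comm (f : Field) (n : Val f) : Provable (dup * test f n) (test f n * dup)
  | pa_mod_filter (f : Field) (n : Val f) : Provable (mod f n * test f n) (mod f n)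
  | pa_filter_mod (f : Field) (n : Val f) : Provable (test f n * mod f n) (test f n)
  | pa_mod_mod (f : Field) (n n' : Val f) : Provable (mod f n * mod f n') (mod f n')
  | pa_contra (f : Field) {n n' : Val f} : n ≠ n' → Provable (test f n * test f n') 0
  | pa_match_all (f : Field) : Provable (sumTests f) 1

end NetKAT

namespace NetKAT

variable {Field : Type u} {Val : Field → Type v}

/-! The star axioms do not make `p*` the supremum of its powers, so the backward direction is not
pure Kleene algebra. It is settled semantically: `provable_zero_iff` shows that `e ≡ 0` is derivable
exactly when `e` relates no two packets. In relations, a star is the union of the finite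
repetitions, and both directions follow.

Soundness (`Provable.rel_iff`) gives one half of the criterion. For the other half, work in the
Kleene algebra of policies modulo provability. There `1` is the finite sum of the pairwise
orthogonal atoms, one per packet, and `atom_mul_cls_mul_atom` shows `atom x * p * atom y = 0`
whenever `p` does not relate `x` to `y`. The hard case is star, where the set of reachable packets
serves as invariant. -/

/-! ### Relational semantics

Histories do not matter for emptiness, so `dup` is interpreted as the identity relation on packets. -/

/-- The packets satisfying a predicate. -/
def Pred.Holds : Pred Field Val → (∀ f, Val f) → Prop
  | .one, _ => True
  | .zero, _ => False
  | .test f n, x => x f = n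
  | .or a b, x => a.Holds x ∨ b.Holds x
  | .and a b, x => a.Holds x ∧ b.Holds x
  | .not a, x => ¬ a.Holds x

open Classical in
/-- The input-output relation of a policy on packets. -/
def Policy.Rel : Policy Field Val → (∀ f, Val f) → (∀ f, Val f) → Prop
  | .one, x, y => x = y
  | .zero, _, _ => False
  | .test f n, x, y => x = y ∧ x f = n
  | .not a, x, y => x = y ∧ ¬ a.Holds x
  | .mod f n, x, y => y = Function.update x f n
  | .union p q, x, y => p.Rel x y ∨ q.Rel x y
  | .seq p q, x, y => ∃ z, p.Rel x z ∧ q.Rel z y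
  | .star p, x, y => Relation.ReflTransGen p.Rel x y
  | .dup, x, y => x = y

namespace Policy

variable {x y : ∀ f, Val f}

theorem rel_one : (1 : Policy Field Val).Rel x y ↔ x = y := Iff.rfl

theorem rel_zero : (0 : Policy Field Val).Rel x y ↔ False := Iff.rfl

theorem rel_add {p q : Policy Field Val} : (p + q).Rel x y ↔ p.Rel x y ∨ q.Rel x y := Iff.rfl

theorem rel_mul {p q : Policy Field Val} : (p * q).Rel x y ↔ ∃ z, p.Rel x z ∧ q.Rel z y := Iff.rfl

theorem rel_test {f : Field} {n : Val f} : (test f n).Rel x y ↔ x = y ∧ x f = n := Iff.rfl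

theorem rel_not {a : Pred Field Val} : (Policy.not a).Rel x y ↔ x = y ∧ ¬ a.Holds x := Iff.rfl

open Classical in
theorem rel_mod {f : Field} {n : Val f} : (mod f n).Rel x y ↔ y = Function.update x f n := Iff.rfl

theorem rel_star {p : Policy Field Val} : (star p).Rel x y ↔ Relation.ReflTransGen p.Rel x y :=
  Iff.rfl

theorem rel_dup : (dup : Policy Field Val).Rel x y ↔ x = y := Iff.rfl

theorem rel_toPolicy (a : Pred Field Val) (x y : ∀ f, Val f) :
    a.toPolicy.Rel x y ↔ x = y ∧ a.Holds x := by
  induction a generalizing x y with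
  | one => simp [Pred.toPolicy, rel_one, Pred.Holds]
  | zero => simp [Pred.toPolicy, rel_zero, Pred.Holds]
  | test f n => simp [Pred.toPolicy, rel_test, Pred.Holds]
  | or a b iha ihb => simp only [Pred.toPolicy, rel_add, Pred.Holds, iha, ihb]; tauto
  | and a b iha ihb =>
    simp only [Pred.toPolicy, rel_mul, Pred.Holds, iha, ihb]
    constructor
    · rintro ⟨z, ⟨rfl, h⟩, rfl, h'⟩
      exact ⟨rfl, h, h'⟩
    · rintro ⟨rfl, h, h'⟩
      exact ⟨x, ⟨rfl, h⟩, rfl, h'⟩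
  | not a => simp [Pred.toPolicy, rel_not, Pred.Holds]

theorem rel_sumTests (f : Field) [Fintype (Val f)] (x y : ∀ f, Val f) :
    (sumTests f : Policy Field Val).Rel x y ↔ x = y := by
  have key : ∀ l : List (Val f),
      ((l.map (fun i => test f i)).foldr (· + ·) (0 : Policy Field Val)).Rel x y ↔
        x = y ∧ x f ∈ l := by
    intro l
    induction l with
    | nil => simp [rel_zero]
    | cons i l ih =>
      simp only [List.map_cons, List.foldr_cons, rel_add, ih, rel_test, List.mem_cons]
      tauto
  simp [sumTests, key]

/-- The witness is the number of steps of the path. -/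
theorem exists_rel_rep_of_rel_star {q : Policy Field Val} (h : (star q).Rel x y) :
    ∃ n, (rep (1 + q) n).Rel x y := by
  rw [rel_star] at h
  induction h using Relation.ReflTransGen.head_induction_on with
  | refl => exact ⟨0, rfl⟩
  | head h _ ih =>
    obtain ⟨n, hn⟩ := ih
    exact ⟨n + 1, _, Or.inr h, hn⟩

theorem rel_star_of_rel_rep {q : Policy Field Val} {n : ℕ}
    (h : (rep (1 + q) n).Rel x y) : (star q).Rel x y := by
  induction n generalizing x with
  | zero => exact (show x = y from h) ▸ .refl
  | succ n ih =>
    obtain ⟨z, rfl | hz, h'⟩ := h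
    · exact ih h'
    · exact .head hz (ih h')

end Policy

/-! ### Soundness of the axioms for the relational semantics. -/

section

variable [∀ f, Fintype (Val f)]

open Policy in
theorem Provable.rel_iff {p q : Policy Field Val} (h : Provable p q) :
    ∀ x y, p.Rel x y ↔ q.Rel x y := by
  classical
  induction h with
  | refl p => exact fun _ _ => Iff.rfl
  | symm _ ih => exact fun x y => (ih x y).symm
  | trans _ _ ih ih' => exact fun x y => (ih x y).trans (ih' x y)
  | union_congr _ _ ih ih' => intro x y; simp only [rel_add, ih, ih']
  | seq_congr _ _ ih ih' => intro x y; simp only [rel_mul, ih, ih']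
  | @star_congr p p' _ ih =>
    have : p.Rel = p'.Rel := by ext x y; exact ih x y
    intro x y; simp only [rel_star, this]
  | not_congr _ ih =>
    intro x y
    -- A filter relates a packet only to itself, so the diagonal determines the predicate.
    have := ih x x
    simp only [rel_toPolicy, true_and] at this
    simp only [rel_not, this]
  | ka_plus_assoc p q r => intro x y; simp only [rel_add, or_assoc]
  | ka_plus_comm p q => intro x y; simp only [rel_add, or_comm]
  | ka_plus_zero p => intro x y; simp only [rel_add, rel_zero, or_false]
  | ka_plus_idem p => intro x y; simp only [rel_add, or_self]
  | ka_seq_assoc p q r =>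
    intro x y; simp only [rel_mul]
    constructor
    · rintro ⟨z, h, w, h', h''⟩; exact ⟨w, ⟨z, h, h'⟩, h''⟩
    · rintro ⟨w, ⟨z, h, h'⟩, h''⟩; exact ⟨z, h, w, h', h''⟩
  | ka_one_seq p => intro x y; simp [rel_mul, rel_one]
  | ka_seq_one p => intro x y; simp [rel_mul, rel_one]
  | ka_seq_dist_l p q r => intro x y; simp only [rel_mul, rel_add, and_or_left, exists_or]
  | ka_seq_dist_r p q r => intro x y; simp only [rel_mul, rel_add, or_and_right, exists_or]
  | ka_zero_seq p => intro x y; simp [rel_mul, rel_zero]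
  | ka_seq_zero p => intro x y; simp [rel_mul, rel_zero]
  | ka_unroll_l p =>
    intro x y; simp only [rel_mul, rel_add, rel_one, rel_star]
    rw [Relation.ReflTransGen.cases_head_iff]
  | ka_unroll_r p =>
    intro x y; simp only [rel_mul, rel_add, rel_one, rel_star]
    rw [Relation.ReflTransGen.cases_tail_iff, eq_comm (a := x)]
  | ka_lfp_l _ ih =>
    intro x y
    simp only [rel_mul, rel_add, rel_star, or_iff_right_iff_imp] at ih ⊢
    rintro ⟨z, h, hq⟩
    induction h using Relation.ReflTransGen.head_induction_on with
    | refl => exact ih _ _ (Or.inl hq)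
    | head h _ ih' => exact ih _ _ (Or.inr ⟨_, h, ih'⟩)
  | ka_lfp_r _ ih =>
    intro x y
    simp only [rel_mul, rel_add, rel_star, or_iff_right_iff_imp] at ih ⊢
    rintro ⟨z, hp, h⟩
    induction h with
    | refl => exact ih _ _ (Or.inl hp)
    | tail _ h ih' => exact ih _ _ (Or.inr ⟨_, ih', h⟩)
  | ba_plus_dist a b c =>
    intro x y
    -- Both sides are images of compound predicates, which reduces the Boolean axioms to
    -- propositional tautologies.
    change (a.or (b.and c)).toPolicy.Rel x y ↔ ((a.or b).and (a.or c)).toPolicy.Rel x y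
    simp only [rel_toPolicy, Pred.Holds]; tauto
  | ba_plus_one a =>
    intro x y
    change (a.or .one).toPolicy.Rel x y ↔ Pred.one.toPolicy.Rel x y
    simp only [rel_toPolicy, Pred.Holds]; tauto
  | ba_excl_mid a =>
    intro x y
    change (a.or a.not).toPolicy.Rel x y ↔ Pred.one.toPolicy.Rel x y
    simp only [rel_toPolicy, Pred.Holds]; tauto
  | ba_seq_comm a b =>
    intro x y
    change (a.and b).toPolicy.Rel x y ↔ (b.and a).toPolicy.Rel x y
    simp only [rel_toPolicy, Pred.Holds]; tauto
  | ba_contra a =>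
    intro x y
    change (a.and a.not).toPolicy.Rel x y ↔ Pred.zero.toPolicy.Rel x y
    simp only [rel_toPolicy, Pred.Holds]; tauto
  | ba_seq_idem a =>
    intro x y
    change (a.and a).toPolicy.Rel x y ↔ a.toPolicy.Rel x y
    simp only [rel_toPolicy, Pred.Holds]; tauto
  | pa_mod_mod_comm n n' h =>
    intro x y; simp [rel_mul, rel_mod, Function.update_comm h]
  | pa_mod_filter_comm n n' h =>
    intro x y; simp [rel_mul, rel_mod, rel_test, Function.update_of_ne (Ne.symm h)]
    constructor
    · rintro ⟨rfl, h⟩; exact ⟨h, rfl⟩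
    · rintro ⟨h, rfl⟩; exact ⟨rfl, h⟩
  | pa_dup_filter_comm f n => intro x y; simp [rel_mul, rel_dup, rel_test]
  | pa_mod_filter f n => intro x y; simp [rel_mul, rel_mod, rel_test, eq_comm]
  | pa_filter_mod f n =>
    intro x y; simp only [rel_mul, rel_mod, rel_test]
    constructor
    · rintro ⟨z, ⟨rfl, rfl⟩, rfl⟩; simp
    · rintro ⟨rfl, rfl⟩; exact ⟨x, ⟨rfl, rfl⟩, by simp⟩
  | pa_mod_mod f n n' => intro x y; simp [rel_mul, rel_mod]
  | pa_contra f h =>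
    intro x y; simp only [rel_mul, rel_test, rel_zero, iff_false]
    rintro ⟨z, ⟨rfl, rfl⟩, rfl, h'⟩
    exact h h'
  | pa_match_all f => intro x y; rw [rel_sumTests, rel_one]

end

/-! ### The Kleene algebra of policies up to provable equality -/

variable (Field Val) in
/-- Provable equality as an equivalence relation. -/
def provableSetoid [∀ f, Fintype (Val f)] : Setoid (Policy Field Val) where
  r := Provable
  iseqv := ⟨.refl, .symm, .trans⟩

variable (Field Val) in
/-- Policies up to provable equality. -/
def PolicyClass [∀ f, Fintype (Val f)] : Type (max u v) := Quotient (provableSetoid Field Val)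

variable [∀ f, Fintype (Val f)]

/-- The class of a policy. -/
def Policy.cls (p : Policy Field Val) : PolicyClass Field Val := Quotient.mk _ p

open Policy

theorem cls_eq_iff {p q : Policy Field Val} : p.cls = q.cls ↔ Provable p q := Quotient.eq

theorem Provable.cls_eq {p q : Policy Field Val} (h : Provable p q) : p.cls = q.cls :=
  cls_eq_iff.2 h

theorem PolicyClass.ind {P : PolicyClass Field Val → Prop} (h : ∀ p : Policy Field Val, P p.cls)
    (a : PolicyClass Field Val) : P a :=
  Quotient.ind h a

instance : Zero (PolicyClass Field Val) := ⟨cls 0⟩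
instance : One (PolicyClass Field Val) := ⟨cls 1⟩
instance : Add (PolicyClass Field Val) :=
  ⟨Quotient.map₂ (· + ·) fun _ _ h _ _ h' => Provable.union_congr h h'⟩
instance : Mul (PolicyClass Field Val) :=
  ⟨Quotient.map₂ (· * ·) fun _ _ h _ _ h' => Provable.seq_congr h h'⟩
instance : KStar (PolicyClass Field Val) :=
  ⟨Quotient.map star fun _ _ h => Provable.star_congr h⟩

theorem cls_zero : (0 : Policy Field Val).cls = 0 := rfl
theorem cls_one : (1 : Policy Field Val).cls = 1 := rfl
theorem cls_add (p q : Policy Field Val) : (p + q).cls = p.cls + q.cls := rfl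
theorem cls_mul (p q : Policy Field Val) : (p * q).cls = p.cls * q.cls := rfl

open Computability in
theorem cls_star (p : Policy Field Val) : (star p).cls = p.cls∗ := rfl

instance : Semiring (PolicyClass Field Val) where
  add_assoc := by
    intro a b c
    induction a using PolicyClass.ind; induction b using PolicyClass.ind
    induction c using PolicyClass.ind
    exact (Provable.ka_plus_assoc _ _ _).symm.cls_eq
  zero_add := by
    intro a
    induction a using PolicyClass.ind
    exact ((Provable.ka_plus_comm _ _).trans (Provable.ka_plus_zero _)).cls_eq
  add_zero := by
    intro a
    induction a using PolicyClass.ind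
    exact (Provable.ka_plus_zero _).cls_eq
  add_comm := by
    intro a b
    induction a using PolicyClass.ind; induction b using PolicyClass.ind
    exact (Provable.ka_plus_comm _ _).cls_eq
  nsmul := nsmulRec
  mul_assoc := by
    intro a b c
    induction a using PolicyClass.ind; induction b using PolicyClass.ind
    induction c using PolicyClass.ind
    exact (Provable.ka_seq_assoc _ _ _).symm.cls_eq
  one_mul := by
    intro a
    induction a using PolicyClass.ind
    exact (Provable.ka_one_seq _).cls_eq
  mul_one := by
    intro a
    induction a using PolicyClass.ind
    exact (Provable.ka_seq_one _).cls_eq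
  zero_mul := by
    intro a
    induction a using PolicyClass.ind
    exact (Provable.ka_zero_seq _).cls_eq
  mul_zero := by
    intro a
    induction a using PolicyClass.ind
    exact (Provable.ka_seq_zero _).cls_eq
  left_distrib := by
    intro a b c
    induction a using PolicyClass.ind; induction b using PolicyClass.ind
    induction c using PolicyClass.ind
    exact (Provable.ka_seq_dist_l _ _ _).cls_eq
  right_distrib := by
    intro a b c
    induction a using PolicyClass.ind; induction b using PolicyClass.ind
    induction c using PolicyClass.ind
    exact (Provable.ka_seq_dist_r _ _ _).cls_eq

instance : IdemSemiring (PolicyClass Field Val) :=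
  IdemSemiring.ofSemiring fun a => by
    induction a using PolicyClass.ind
    exact (Provable.ka_plus_idem _).cls_eq

theorem cls_le_iff {p q : Policy Field Val} : p.cls ≤ q.cls ↔ Provable (p + q) q := by
  rw [← add_eq_right_iff_le, ← cls_add, cls_eq_iff]

open Computability in
instance : KleeneAlgebra (PolicyClass Field Val) where
  one_le_kstar a := by
    induction a using PolicyClass.ind with | _ p
    rw [← cls_star, ← (Provable.ka_unroll_l p).cls_eq]
    rw [cls_add, add_eq_sup]
    exact le_sup_left
  mul_kstar_le_kstar a := by
    induction a using PolicyClass.ind with | _ p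
    conv_rhs => rw [← cls_star, ← (Provable.ka_unroll_l p).cls_eq]
    rw [cls_add, add_eq_sup]
    exact le_sup_right
  kstar_mul_le_kstar a := by
    induction a using PolicyClass.ind with | _ p
    conv_rhs => rw [← cls_star, ← (Provable.ka_unroll_r p).cls_eq]
    rw [cls_add, add_eq_sup]
    exact le_sup_right
  mul_kstar_le_self a b := by
    induction a using PolicyClass.ind with | _ p
    induction b using PolicyClass.ind with | _ q
    intro h
    -- The induction axiom `p + q·r ≤ q → p·r* ≤ q` is used with `p = q`; the left-hand rule is
    -- treated likewise.
    refine cls_le_iff.2 (Provable.ka_lfp_r (cls_le_iff.1 ?_))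
    rw [cls_add]
    exact add_le le_rfl h
  kstar_mul_le_self a b := by
    induction a using PolicyClass.ind with | _ p
    induction b using PolicyClass.ind with | _ q
    intro h
    refine cls_le_iff.2 (Provable.ka_lfp_l (cls_le_iff.1 ?_))
    rw [cls_add]
    exact add_le le_rfl h

/-! ### Atoms -/

theorem cls_toPolicy_commute (a b : Pred Field Val) :
    a.toPolicy.cls * b.toPolicy.cls = b.toPolicy.cls * a.toPolicy.cls :=
  (Provable.ba_seq_comm a b).cls_eq

theorem test_commute (f f' : Field) (n : Val f) (n' : Val f') :
    (test f n).cls * (test f' n').cls = (test f' n').cls * (test f n).cls :=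
  cls_toPolicy_commute (.test f n) (.test f' n')

theorem test_mul_test (f : Field) {n n' : Val f} (h : n ≠ n') :
    (test f n).cls * (test f n').cls = 0 :=
  (Provable.pa_contra f h).cls_eq

theorem test_mul_self (f : Field) (n : Val f) :
    (test f n).cls * (test f n).cls = (test f n).cls :=
  (Provable.ba_seq_idem (.test f n)).cls_eq

theorem sum_test (f : Field) : ∑ n : Val f, (test f n).cls = 1 := by
  rw [← cls_one, ← (Provable.pa_match_all f).cls_eq, sumTests, ← Finset.sum_map_toList]
  induction (Finset.univ : Finset (Val f)).toList with
  | nil => rfl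
  | cons i l ih => simp only [List.map_cons, List.sum_cons, List.foldr_cons, cls_add, ih]

variable (Field Val) in
/-- The subsemiring generated by the tests. -/
def testSubsemiring : Subsemiring (PolicyClass Field Val) :=
  Subsemiring.closure {a | ∃ (f : Field) (n : Val f), a = (test f n).cls}

/-- The tests commute with each other. -/
instance : IsMulCommutative (testSubsemiring Field Val) :=
  Subsemiring.isMulCommutative_closure <| by
    rintro _ ⟨f, n, rfl⟩ _ ⟨f', n', rfl⟩
    exact test_commute f f' n n'

/-- A test as an element of `testSubsemiring`. -/
def testElem (f : Field) (n : Val f) : testSubsemiring Field Val :=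
  ⟨(test f n).cls, Subsemiring.subset_closure ⟨f, n, rfl⟩⟩

variable [Fintype Field]

-- Products over all fields need commutativity, which holds in `testSubsemiring` but is not
-- available for all policy classes.
open scoped IsMulCommutative

/-- The conjunction of all tests satisfied by the packet `x`. -/
noncomputable def atom (x : ∀ f, Val f) : PolicyClass Field Val :=
  (∏ f, testElem f (x f) : testSubsemiring Field Val)

-- Expand the product over all fields `f` of `Σ n, f = n`, each factor of which is `1`.
open Classical in
theorem sum_atom : ∑ x : ∀ f, Val f, atom x = (1 : PolicyClass Field Val) := by
  have h : ∀ f : Field, ∑ n : Val f, testElem f n = 1 := fun f =>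
    Subtype.ext ((AddSubmonoidClass.coe_finsetSum _ _).trans (sum_test f))
  have h' := Finset.prod_univ_sum (fun f : Field => (Finset.univ : Finset (Val f)))
    (fun f n => testElem f n)
  simp only [h, Finset.prod_const_one, Fintype.piFinset_univ] at h'
  have h'' := congrArg (Subtype.val) h'
  exact (((AddSubmonoidClass.coe_finsetSum _ _).symm.trans h''.symm) :)

/-- Since tests commute, the factor for `f` can be moved to either end. -/
theorem exists_atom_eq (x : ∀ f, Val f) (f : Field) :
    ∃ c : PolicyClass Field Val,
      atom x = (test f (x f)).cls * c ∧ atom x = c * (test f (x f)).cls := by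
  classical
  refine ⟨(∏ g ∈ Finset.univ.erase f, testElem g (x g) : testSubsemiring Field Val), ?_, ?_⟩
  · exact congrArg Subtype.val
      (Finset.mul_prod_erase Finset.univ (fun g => testElem g (x g)) (Finset.mem_univ f)).symm
  · exact congrArg Subtype.val
      (Finset.prod_erase_mul Finset.univ (fun g => testElem g (x g)) (Finset.mem_univ f)).symm

theorem atom_mul_test (x : ∀ f, Val f) (f : Field) :
    atom x * (test f (x f)).cls = atom x := by
  obtain ⟨c, -, h⟩ := exists_atom_eq x f
  rw [h, mul_assoc, test_mul_self]

theorem test_mul_atom (x : ∀ f, Val f) (f : Field) :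
    (test f (x f)).cls * atom x = atom x := by
  obtain ⟨c, h, -⟩ := exists_atom_eq x f
  rw [h, ← mul_assoc, test_mul_self]

theorem atom_mul_test_of_ne (x : ∀ f, Val f) {f : Field} {n : Val f} (h : x f ≠ n) :
    atom x * (test f n).cls = 0 := by
  rw [← atom_mul_test x f, mul_assoc, test_mul_test f h, mul_zero]

theorem atom_mul_atom {x y : ∀ f, Val f} (h : x ≠ y) : atom x * atom y = 0 := by
  obtain ⟨f, hf⟩ := Function.ne_iff.1 h
  rw [← test_mul_atom y f, ← mul_assoc, atom_mul_test_of_ne x hf, zero_mul]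

theorem atom_le_one (x : ∀ f, Val f) : atom x ≤ 1 := by
  classical
  rw [← sum_atom]
  exact Finset.single_le_sum (f := atom) (fun _ _ => bot_le) (Finset.mem_univ x)

/-- An atom decides every predicate. The two halves are proved together because negation exchanges
them. -/
theorem atom_mul_toPolicy (x : ∀ f, Val f) (a : Pred Field Val) :
    (a.Holds x → atom x * a.toPolicy.cls = atom x) ∧
      (¬ a.Holds x → atom x * a.toPolicy.cls = 0) := by
  induction a with
  | one => simp [Pred.Holds, Pred.toPolicy, cls_one]
  | zero => simp [Pred.Holds, Pred.toPolicy, cls_zero]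
  | test f n =>
    refine ⟨?_, fun h => atom_mul_test_of_ne x h⟩
    rintro rfl
    exact atom_mul_test x f
  | or a b iha ihb =>
    simp only [Pred.Holds, Pred.toPolicy, cls_add, mul_add]
    by_cases ha : a.Holds x <;> by_cases hb : b.Holds x <;> simp_all [add_idem]
  | and a b iha ihb =>
    simp only [Pred.Holds, Pred.toPolicy, cls_mul, ← mul_assoc]
    by_cases ha : a.Holds x <;> by_cases hb : b.Holds x <;> simp_all
  | not a ih =>
    have hc : a.toPolicy.cls * (Policy.not a).cls = 0 := (Provable.ba_contra a).cls_eq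
    have he : a.toPolicy.cls + (Policy.not a).cls = 1 := (Provable.ba_excl_mid a).cls_eq
    simp only [Pred.Holds, Pred.toPolicy, not_not]
    constructor
    · intro h
      conv_rhs => rw [← mul_one (atom x), ← he, mul_add, ih.2 h, zero_add]
    · intro h
      rw [← ih.1 h, mul_assoc, hc, mul_zero]

-- Insert `1 = Σ z, atom z` between the factors and double each atom by idempotence, so that a
-- composition splits over its intermediate packet.
open Classical in
theorem eq_sum_mul_atom_mul (a b : PolicyClass Field Val) :
    a * b = ∑ z : ∀ f, Val f, (a * atom z) * (atom z * b) := by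
  have h : ∀ z : ∀ f, Val f, (a * atom z) * (atom z * b) = a * atom z * b := by
    intro z
    have hz : atom z * atom z = atom z := by
      conv_rhs => rw [← mul_one (atom z), ← sum_atom, Finset.mul_sum]
      exact (Finset.sum_eq_single z (fun w _ hw => atom_mul_atom hw.symm) (by simp)).symm
    rw [mul_assoc, ← mul_assoc (atom z), hz, mul_assoc]
  simp only [h, ← Finset.sum_mul, ← Finset.mul_sum, sum_atom, mul_one]

/-! ### Completeness for emptiness -/

-- Let `T` be the sum of the atoms reachable from `x`. Reachability is closed under steps, so `T * a
-- ≤ a * T`; star induction then gives `atom x * a∗ ≤ a∗ * T`, and `T` annihilates the unreachable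
-- `atom y`.
open Classical Computability in
theorem atom_mul_kstar_mul_atom {R : (∀ f, Val f) → (∀ f, Val f) → Prop}
    {a : PolicyClass Field Val} (h : ∀ x y, ¬ R x y → atom x * a * atom y = 0)
    {x y : ∀ f, Val f} (hxy : ¬ Relation.ReflTransGen R x y) :
    atom x * a∗ * atom y = 0 := by
  set S : Finset (∀ f, Val f) := Finset.univ.filter (Relation.ReflTransGen R x) with hS
  set T : PolicyClass Field Val := ∑ z ∈ S, atom z with hT
  have mem : ∀ z, z ∈ S ↔ Relation.ReflTransGen R x z := by simp [hS]
  have le_T : ∀ z ∈ S, atom z ≤ T := fun z hz =>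
    Finset.single_le_sum (f := atom) (fun _ _ => bot_le) hz
  have T_mul : T * a ≤ a * T := by
    rw [hT, Finset.sum_mul]
    refine Finset.sum_induction _ (· ≤ a * T) (fun _ _ => add_le) bot_le fun z hz => ?_
    rw [← mul_one (atom z * a), ← sum_atom, Finset.mul_sum]
    refine Finset.sum_induction _ (· ≤ a * T) (fun _ _ => add_le) bot_le fun w _ => ?_
    -- Either `w` is again reachable, and its atom lies below `T`, or the term vanishes by
    -- hypothesis.
    by_cases hzw : R z w
    · rw [mul_assoc]
      refine (mul_le_mul' (atom_le_one z) le_rfl).trans ?_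
      rw [one_mul]
      exact mul_le_mul' le_rfl (le_T w ((mem w).2 (((mem z).1 hz).tail hzw)))
    · rw [h z w hzw]
      exact bot_le
  have key : atom x * a∗ ≤ a∗ * T := by
    have h₁ : a∗ * T * a∗ ≤ a∗ * T := by
      refine mul_kstar_le_self ?_
      calc a∗ * T * a ≤ a∗ * (a * T) := by rw [mul_assoc]; exact mul_le_mul' le_rfl T_mul
        _ = a∗ * a * T := (mul_assoc _ _ _).symm
        _ ≤ a∗ * T := mul_le_mul' kstar_mul_le_kstar le_rfl
    refine le_trans (mul_le_mul' ?_ le_rfl) h₁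
    calc atom x ≤ T := le_T x ((mem x).2 .refl)
      _ = 1 * T := (one_mul _).symm
      _ ≤ a∗ * T := mul_le_mul' one_le_kstar le_rfl
  have hTy : T * atom y = 0 := by
    rw [hT, Finset.sum_mul]
    refine Finset.sum_eq_zero fun z hz => atom_mul_atom ?_
    rintro rfl
    exact hxy ((mem z).1 hz)
  refine le_antisymm ?_ bot_le
  calc atom x * a∗ * atom y ≤ a∗ * T * atom y := mul_le_mul' key le_rfl
    _ = 0 := by rw [mul_assoc, hTy, mul_zero]

/-- Pick a field `g` where `y` differs from the updated packet. If `g = f`, the test `f = n` implied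
by the assignment contradicts `atom y`; otherwise the test `g = y g` commutes past the assignment
and contradicts `atom x`. -/
theorem atom_mul_mod_mul_atom {x y : ∀ f, Val f} {f : Field} {n : Val f}
    (h : ¬ (mod f n).Rel x y) : atom x * (mod f n).cls * atom y = 0 := by
  classical
  obtain ⟨g, hg⟩ := Function.ne_iff.1 (rel_mod.not.1 h)
  by_cases hgf : g = f
  · subst hgf
    rw [Function.update_self] at hg
    have hm : (mod g n).cls * (test g n).cls = (mod g n).cls := (Provable.pa_mod_filter g n).cls_eq
    rw [← test_mul_atom y g, ← hm]
    simp only [mul_assoc]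
    rw [← mul_assoc (test g n).cls, test_mul_test g hg.symm]
    simp
  · rw [Function.update_of_ne hgf] at hg
    have hc : (mod f n).cls * (test g (y g)).cls = (test g (y g)).cls * (mod f n).cls :=
      (Provable.pa_mod_filter_comm n (y g) (Ne.symm hgf)).cls_eq
    rw [← test_mul_atom y g, mul_assoc, ← mul_assoc (mod f n).cls, hc]
    simp only [← mul_assoc]
    rw [atom_mul_test_of_ne x hg.symm]
    simp

theorem atom_mul_cls_mul_atom (p : Policy Field Val) {x y : ∀ f, Val f} (h : ¬ p.Rel x y) :
    atom x * p.cls * atom y = 0 := by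
  classical
  induction p generalizing x y with
  | one =>
    change atom x * 1 * atom y = 0
    rw [mul_one, atom_mul_atom h]
  | zero =>
    change atom x * 0 * atom y = 0
    rw [mul_zero, zero_mul]
  | test f n =>
    by_cases hf : x f = n
    · subst hf
      rw [atom_mul_test, atom_mul_atom fun hxy => h ⟨hxy, rfl⟩]
    · rw [atom_mul_test_of_ne x hf, zero_mul]
  | not a =>
    by_cases ha : a.Holds x
    · have := (atom_mul_toPolicy x a.not).2 (not_not.2 ha)
      rw [Pred.toPolicy] at this
      rw [this, zero_mul]
    · have := (atom_mul_toPolicy x a.not).1 ha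
      rw [Pred.toPolicy] at this
      rw [this, atom_mul_atom fun hxy => h ⟨hxy, ha⟩]
  | mod f n => exact atom_mul_mod_mul_atom h
  | union p q ihp ihq =>
    change atom x * (p.cls + q.cls) * atom y = 0
    rw [mul_add, add_mul, ihp fun h' => h (.inl h'), ihq fun h' => h (.inr h'), add_zero]
  | seq p q ihp ihq =>
    change atom x * (p.cls * q.cls) * atom y = 0
    rw [← mul_assoc, mul_assoc, eq_sum_mul_atom_mul]
    refine Finset.sum_eq_zero fun z _ => ?_
    by_cases hp : p.Rel x z
    · rw [← mul_assoc (atom z), ihq fun hq => h ⟨z, hp, hq⟩, mul_zero]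
    · rw [ihp hp, zero_mul]
  | star p ih => exact atom_mul_kstar_mul_atom (fun _ _ => ih) h
  | dup =>
    -- Tests commute with `dup`, so a test separating `y` from `x` reaches `atom x`.
    obtain ⟨g, hg⟩ := Function.ne_iff.1 (show x ≠ y from h)
    have hc : (dup : Policy Field Val).cls * (test g (y g)).cls = (test g (y g)).cls * dup.cls :=
      (Provable.pa_dup_filter_comm g (y g)).cls_eq
    rw [← test_mul_atom y g, mul_assoc, ← mul_assoc dup.cls, hc]
    simp only [← mul_assoc]
    rw [atom_mul_test_of_ne x hg]
    simp

/-- For completeness, write `p` as `1 * p * 1` and expand both units into atoms; every term of the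
double sum vanishes. -/
theorem provable_zero_iff (p : Policy Field Val) : Provable p 0 ↔ ∀ x y, ¬ p.Rel x y := by
  classical
  refine ⟨fun h x y hxy => (h.rel_iff x y).1 hxy, fun h => cls_eq_iff.1 ?_⟩
  rw [cls_zero, ← one_mul p.cls, ← mul_one (1 * p.cls), ← sum_atom]
  simp only [Finset.sum_mul, Finset.mul_sum]
  exact Finset.sum_eq_zero fun y _ => Finset.sum_eq_zero fun x _ => atom_mul_cls_mul_atom p (h _ _)

end NetKAT

theorem theorem1 {Field : Type u} [Fintype Field] {Val : Field → Type v} [∀ f, Fintype (Val f)]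
    (t p ingress egress : NetKAT.Policy Field Val) :
    NetKAT.Provable (ingress * NetKAT.Policy.star (p * t) * egress) 0 ↔
      ∀ n : ℕ, NetKAT.Provable (ingress * NetKAT.Policy.rep (1 + p * t) n * egress) 0 := by
  simp only [NetKAT.provable_zero_iff]
  constructor
  · rintro h n x y ⟨w, ⟨z, hi, hn⟩, ho⟩
    exact h x y ⟨w, ⟨z, hi, NetKAT.Policy.rel_star_of_rel_rep hn⟩, ho⟩
  · rintro h x y ⟨w, ⟨z, hi, hs⟩, ho⟩
    obtain ⟨n, hn⟩ := NetKAT.Policy.exists_rel_rep_of_rel_star hs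
    exact h n x y ⟨w, ⟨z, hi, hn⟩, ho⟩
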